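/- Let $A$ and $Z$ be complex $n\times n$ matrices such that $A$ is positive semidefinite and $Z$ is expansive, that is, $Z^*Z\ge I$ in the positive semidefinite order. Let $f:[0,\infty)\to[0,\infty)$ be a concave function. Then, for every symmetric norm $\|\cdot\|$ on the $n\times n$ complex matrices, that is, every norm satisfying $\|UXV\|=\|X\|$ for all matrices $X$ and all unitary matrices $U,V$, one has $$\|f(Z^*AZ)\|\le\|Z^*f(A)Z\|,$$ where $f(A)$ and $f(Z^*AZ)$ are defined by the functional calculus for positive semidefinite matrices (apply $f$ to the eigenvalues). -/

import Mathlib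

open scoped Matrix ComplexOrder

/-- `N` is a symmetric norm on the complex square matrices indexed by `n`: a norm (of complex
vector spaces) that is unitarily invariant, `N (U X V) = N X` for all unitaries `U`, `V`. -/
structure IsSymmetricNorm {n : Type*} [Fintype n] [DecidableEq n]
    (N : Matrix n n ℂ → ℝ) : Prop where
  nonneg : ∀ X, 0 ≤ N X
  eq_zero_iff : ∀ X, N X = 0 ↔ X = 0
  smul : ∀ (c : ℂ) (X), N (c • X) = ‖c‖ * N X
  add_le : ∀ X Y, N (X + Y) ≤ N X + N Y
  unitary_mul_mul : ∀ U ∈ Matrix.unitaryGroup n ℂ, ∀ V ∈ Matrix.unitaryGroup n ℂ, ∀ X,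
    N (U * X * V) = N X

/-- `Z` is expansive: `Zᴴ Z ≥ I` in the positive semidefinite order. -/
def IsExpansive {n : Type*} [Fintype n] [DecidableEq n] (Z : Matrix n n ℂ) : Prop :=
  (Zᴴ * Z - 1).PosSemidef

/-!
Diagonalize `A = V diag(a) Vᴴ` and `Zᴴ A Z = U diag(h) Uᴴ` and put `W = Uᴴ Zᴴ V`. Then
`W diag(a) Wᴴ = diag(h)`, both `W Wᴴ ≥ 1` and `Wᴴ W ≥ 1`, and up to unitary conjugation the two
matrices to be compared are `diag(f h)` and `K = W diag(f a) Wᴴ`.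

The heart of the matter is that the diagonal of `K` weakly majorizes `f h`
(`sum_map_le_sum_diag`): for each set `T` of indices of largest entries of `h`,
`∑_{j ∈ T} f (h j) ≤ ∑_{j ∈ T} K j j`. After subtracting the constant `f 0`, which is handled by
`W Wᴴ ≥ 1`, this splits into one inequality for each eigenvalue `a i > 0`. With
`m j = ‖W j i‖ ^ 2` and `φ t = (f t - f 0) / t`, which is antitone, it reads
`∑_{j ∈ T} m j * (φ (a i) - φ (h j)) ≥ 0`. If `h ≥ a i` on `T`, all terms are nonnegative.
Otherwise `h ≤ a i` off `T`, so the terms off `T` are nonpositive and it is enough that the sum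
over all `j` is nonnegative. That follows from the supporting line of `f` at `a i`, from
`∑ m j ≥ 1` (as `Wᴴ W ≥ 1`), and from `∑ m j / h j ≤ 1 / a i`, which expresses that `diag(h)`
dominates the rank-one matrix `a i • w wᴴ` with `w` the `i`-th column of `W`.

The norm of real diagonal matrices is a symmetric gauge function, and such functions are monotone
for weak majorization (`IsSymmetricGauge.le_of_sum_le`, by a norming functional, the rearrangement
inequality and Abel summation). Finally the norm of the diagonal part of `K` is at most that of `K`,
since the diagonal part is an average of conjugates of `K` by diagonal sign matrices
(`IsSymmetricNorm.diagonal_diag_le`).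
-/

/-! ### Concave functions on the half-line -/

theorem ConcaveOn.exists_supporting_slope {g : ℝ → ℝ} (hg : ConcaveOn ℝ (Set.Ici 0) g) {a : ℝ}
    (ha : 0 < a) : ∃ σ : ℝ, ∀ t, 0 ≤ t → g t ≤ g a + σ * (t - a) := by
  obtain ⟨σ, hσ₁, hσ₂⟩ := exists_between_of_forall_le
    (s := (fun y => (g y - g a) / (y - a)) '' Set.Ioi a)
    (t := (fun x => (g a - g x) / (a - x)) '' Set.Ico 0 a)
    ((Set.nonempty_Ioi).image _) ((Set.nonempty_Ico.2 ha).image _) (by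
      rintro _ ⟨y, hy, rfl⟩ _ ⟨x, hx, rfl⟩
      exact hg.slope_anti_adjacent hx.1 (ha.le.trans (le_of_lt hy) : (0 : ℝ) ≤ y) hx.2 hy)
  refine ⟨σ, fun t ht => ?_⟩
  rcases lt_trichotomy t a with h | rfl | h
  · have := hσ₂ ⟨t, ⟨ht, h⟩, rfl⟩
    rw [le_div_iff₀ (by linarith)] at this
    linarith
  · simp
  · have := hσ₁ ⟨t, h, rfl⟩
    rw [div_le_iff₀ (by linarith)] at this
    linarith

/-- The map `t ↦ g t / t` is antitone, cleared of denominators. -/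
theorem ConcaveOn.mul_le_mul_of_map_zero {g : ℝ → ℝ} (hg : ConcaveOn ℝ (Set.Ici 0) g)
    (h0 : g 0 = 0) {s t : ℝ} (hs : 0 ≤ s) (hst : s ≤ t) : s * g t ≤ t * g s := by
  rcases hs.eq_or_lt with rfl | hs
  · simp [h0]
  have ht : 0 < t := hs.trans_le hst
  have h1 : 0 ≤ s / t := by positivity
  have h2 : 0 ≤ 1 - s / t := sub_nonneg.2 ((div_le_one ht).2 hst)
  have := hg.2 (Set.mem_Ici.2 ht.le) (Set.mem_Ici.2 le_rfl) h1 h2 (by ring)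
  simp only [smul_eq_mul, mul_zero, add_zero, h0, div_mul_cancel₀ _ ht.ne'] at this
  calc s * g t = t * (s / t * g t) := by field_simp
    _ ≤ t * g s := by gcongr

theorem ConcaveOn.monotoneOn_of_nonneg {f : ℝ → ℝ} (hf : ConcaveOn ℝ (Set.Ici 0) f)
    (hf0 : ∀ t, 0 ≤ t → 0 ≤ f t) : MonotoneOn f (Set.Ici 0) := by
  intro x hx y hy hxy
  by_contra! hlt
  have hxy' : x < y := lt_of_le_of_ne hxy (by rintro rfl; exact lt_irrefl _ hlt)
  have hd : 0 < f x - f y := sub_pos.2 hlt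
  have hx0 : (0 : ℝ) ≤ x := hx
  have hy0 : (0 : ℝ) ≤ y := hy
  -- the chord through `x` and `y` takes the value `-1` at `z`, and `f z` lies below it
  set z : ℝ := y + (y - x) * (f y + 1) / (f x - f y) with hz
  have hfy := hf0 y hy0
  have hyx : 0 < y - x := sub_pos.2 hxy'
  have hyz : y < z := by rw [hz]; have : 0 < (y - x) * (f y + 1) / (f x - f y) := by positivity
                         linarith
  have h := hf.slope_anti_adjacent hx (hy0.trans hyz.le : (0 : ℝ) ≤ z) hxy' hyz
  rw [div_le_div_iff₀ (sub_pos.2 hyz) hyx] at h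
  have hzy : z - y = (y - x) * (f y + 1) / (f x - f y) := by rw [hz]; ring
  have h2 : (f y - f x) * (z - y) = -((y - x) * (f y + 1)) := by
    rw [hzy]; field_simp; ring
  rw [h2] at h
  have hfz := hf0 z (hy0.trans hyz.le)
  nlinarith

/-- The weight inequality that carries the majorization. The sums run over a set `T` of
largest entries of `h`; the weights `m` have total mass at least `1`, while the weighted sum of the
`1 / h j` is at most `1 / a`. Where `h j = 0` the junk value `g 0 / 0 = 0` is harmless, as `m j`
vanishes there. -/
theorem sum_concave_le_of_sum_div_le {ι : Type*} [Fintype ι] [DecidableEq ι] {g : ℝ → ℝ}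
    (hg : ConcaveOn ℝ (Set.Ici 0) g) (h0 : g 0 = 0) {a : ℝ} (ha : 0 < a) {h m : ι → ℝ}
    (hh : ∀ j, 0 ≤ h j) (hm : ∀ j, 0 ≤ m j) (hm0 : ∀ j, h j = 0 → m j = 0)
    (hm1 : 1 ≤ ∑ j, m j) (hs : ∑ j, m j / h j ≤ 1 / a) {T : Finset ι}
    (hT : ∀ i ∈ T, ∀ j ∉ T, h j ≤ h i) :
    ∑ j ∈ T, m j * (a * (g (h j) / h j)) ≤ ∑ j ∈ T, m j * g a := by
  by_cases hTa : ∀ j ∈ T, a ≤ h j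
  · refine Finset.sum_le_sum fun j hj => mul_le_mul_of_nonneg_left ?_ (hm j)
    have hj0 : 0 < h j := ha.trans_le (hTa j hj)
    rw [← mul_div_assoc, div_le_iff₀ hj0, mul_comm (g a)]
    exact hg.mul_le_mul_of_map_zero h0 ha.le (hTa j hj)
  push Not at hTa
  obtain ⟨i, hi, hia⟩ := hTa
  have hcompl : ∑ j ∈ Tᶜ, m j * g a ≤ ∑ j ∈ Tᶜ, m j * (a * (g (h j) / h j)) := by
    refine Finset.sum_le_sum fun j hj => ?_
    rcases (hh j).eq_or_lt with hj0 | hj0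
    · simp [hm0 j hj0.symm]
    refine mul_le_mul_of_nonneg_left ?_ (hm j)
    rw [← mul_div_assoc, le_div_iff₀ hj0, mul_comm (g a)]
    exact hg.mul_le_mul_of_map_zero h0 hj0.le
      ((hT i hi j (Finset.mem_compl.1 hj)).trans hia.le)
  -- concavity in the form of the supporting line at `a`, whose value at `0` is nonnegative
  have htotal : ∑ j, m j * (a * (g (h j) / h j)) ≤ ∑ j, m j * g a := by
    obtain ⟨σ, hσ⟩ := hg.exists_supporting_slope ha
    have hτ : 0 ≤ g a - σ * a := by have := hσ 0 le_rfl; rw [h0] at this; linarith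
    have hterm : ∀ j, m j * (a * (g (h j) / h j)) ≤
        (g a - σ * a) * a * (m j / h j) + σ * a * m j := by
      intro j
      rcases (hh j).eq_or_lt with hj0 | hj0
      · simp [hm0 j hj0.symm]
      have := hσ (h j) hj0.le
      calc m j * (a * (g (h j) / h j)) = m j * a / h j * g (h j) := by ring
        _ ≤ m j * a / h j * (g a + σ * (h j - a)) := by
          have := hm j
          gcongr
        _ = _ := by field_simp; ring
    calc ∑ j, m j * (a * (g (h j) / h j))
        ≤ ∑ j, ((g a - σ * a) * a * (m j / h j) + σ * a * m j) :=
          Finset.sum_le_sum fun j _ => hterm j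
      _ = (g a - σ * a) * a * ∑ j, m j / h j + σ * a * ∑ j, m j := by
          rw [Finset.sum_add_distrib, Finset.mul_sum, Finset.mul_sum]
      _ ≤ (g a - σ * a) * a * (1 / a) + σ * a * ∑ j, m j := by gcongr
      _ = (g a - σ * a) * 1 + σ * a * ∑ j, m j := by field_simp
      _ ≤ (g a - σ * a) * ∑ j, m j + σ * a * ∑ j, m j := by gcongr
      _ = ∑ j, m j * g a := by rw [← Finset.sum_mul]; ring
  rw [← Finset.sum_add_sum_compl T, ← Finset.sum_add_sum_compl T (fun j => m j * g a)] at htotal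
  linarith

/-! ### Symmetric gauge functions and weak majorization -/

/-- Abel summation: an antitone weight `y - t ≥ 0` pairs nonnegatively with a sequence whose partial
sums are nonnegative. The shift `t` makes the induction on the length work. -/
theorem sum_mul_nonneg_of_antitone {k : ℕ} {c y : Fin k → ℝ} (hy : Antitone y) {t : ℝ}
    (ht : ∀ i, t ≤ y i)
    (hc : ∀ T : Finset (Fin k), (∀ i ∈ T, ∀ j ∉ T, i ≤ j) → 0 ≤ ∑ j ∈ T, c j) :
    0 ≤ ∑ j, c j * (y j - t) := by
  induction k generalizing t with
  | zero => simp
  | succ k ih =>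
    have h1 : 0 ≤ ∑ j : Fin k, c j.castSucc * (y j.castSucc - y (Fin.last k)) := by
      refine ih (c := fun j => c j.castSucc) (y := fun j => y j.castSucc)
        (fun i j hij => hy (Fin.castSucc_le_castSucc_iff.2 hij)) (fun i => hy (Fin.le_last _))
        fun T hT => ?_
      have := hc (T.map Fin.castSuccEmb) (by
        intro i hi j hj
        obtain ⟨i, hiT, rfl⟩ := Finset.mem_map.1 hi
        induction j using Fin.lastCases with
        | last => exact Fin.le_last _
        | cast j =>
          refine Fin.castSucc_le_castSucc_iff.2 (hT i hiT j fun h => hj ?_)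
          exact Finset.mem_map_of_mem _ h)
      simpa using this
    have h2 : 0 ≤ ∑ j, c j := hc Finset.univ (by simp)
    have h3 : ∑ j, c j * (y j - t) = ∑ j : Fin k, c j.castSucc * (y j.castSucc - y (Fin.last k))
        + (y (Fin.last k) - t) * ∑ j, c j := by
      rw [Fin.sum_univ_castSucc, Fin.sum_univ_castSucc c, mul_add, Finset.mul_sum, ← add_assoc,
        ← Finset.sum_add_distrib]
      congr 1
      · exact Finset.sum_congr rfl fun j _ => by ring
      · ring
    rw [h3]
    exact add_nonneg h1 (mul_nonneg (sub_nonneg.2 (ht _)) h2)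

theorem exists_equiv_antitone {ι : Type*} [Fintype ι] (h : ι → ℝ) :
    ∃ r : Fin (Fintype.card ι) ≃ ι, Antitone (h ∘ r) := by
  let r₀ := (Fintype.equivFin ι).symm
  refine ⟨(Tuple.sort fun i => -h (r₀ i)).trans r₀, fun i j hij => ?_⟩
  have := Tuple.monotone_sort (fun i => -h (r₀ i)) hij
  simpa using this

/-- A symmetric gauge function on `ι → ℝ`: a seminorm invariant under permutations and sign changes
of the coordinates. Definiteness plays no role here and is left out. -/
structure IsSymmetricGauge {ι : Type*} (p : (ι → ℝ) → ℝ) : Prop where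
  smul : ∀ (c : ℝ) x, p (c • x) = |c| * p x
  add_le : ∀ x y, p (x + y) ≤ p x + p y
  perm : ∀ (π : Equiv.Perm ι) x, p (x ∘ π) = p x
  sign : ∀ (s : ι → ℝ), (∀ i, |s i| = 1) → ∀ x, p (s * x) = p x

theorem IsSymmetricGauge.nonneg {ι : Type*} {p : (ι → ℝ) → ℝ} (hp : IsSymmetricGauge p)
    (x : ι → ℝ) : 0 ≤ p x := by
  have h0 : p 0 = 0 := by simpa using hp.smul 0 0
  have h1 : p (-x) = p x := by simpa using hp.smul (-1) x
  have h2 := hp.add_le x (-x)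
  rw [add_neg_cancel, h0, h1] at h2
  linarith

/-- A norming functional for `d`, from the Hahn–Banach theorem. -/
theorem IsSymmetricGauge.exists_dual {ι : Type*} [Fintype ι] [DecidableEq ι] {p : (ι → ℝ) → ℝ}
    (hp : IsSymmetricGauge p) (d : ι → ℝ) :
    ∃ y : ι → ℝ, ∑ j, d j * y j = p d ∧ ∀ x : ι → ℝ, ∑ j, x j * y j ≤ p x := by
  rcases eq_or_ne d 0 with rfl | hd
  · exact ⟨0, by simpa using (hp.smul 0 0).symm, fun x => by simpa using hp.nonneg x⟩
  obtain ⟨ℓ, hℓ, hle⟩ := exists_extension_of_le_sublinear (LinearPMap.mkSpanSingleton d (p d) hd) p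
    (fun c hc x => by rw [hp.smul, abs_of_pos hc]) hp.add_le (by
      rintro ⟨x, hx⟩
      obtain ⟨c, rfl⟩ := Submodule.mem_span_singleton.1 hx
      have : LinearPMap.mkSpanSingleton d (p d) hd ⟨c • d, hx⟩ = c • p d :=
        LinearPMap.mkSpanSingleton'_apply _ _ _ c _
      rw [this, hp.smul, smul_eq_mul]
      exact mul_le_mul_of_nonneg_right (le_abs_self c) (hp.nonneg d))
  have hsum : ∀ x : ι → ℝ, ∑ j, x j * ℓ (Pi.single j 1) = ℓ x := fun x => by
    conv_rhs => rw [pi_eq_sum_univ' x, map_sum]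
    simp
  refine ⟨fun j => ℓ (Pi.single j 1), ?_, fun x => (hsum x).trans_le (hle x)⟩
  rw [hsum]
  have := hℓ ⟨d, Submodule.mem_span_singleton_self d⟩
  rw [LinearPMap.mkSpanSingleton_apply] at this
  exact this

/-- Symmetric gauge functions are monotone for weak majorization. The common ordering of the indices
is given by `h`: `d` increases with `h`, and the partial sums of `d` and `e` are compared over the
sets of indices of largest entries of `h`. -/
theorem IsSymmetricGauge.le_of_sum_le {ι : Type*} [Fintype ι] [DecidableEq ι] {p : (ι → ℝ) → ℝ}
    (hp : IsSymmetricGauge p) {h d e : ι → ℝ} (hd : ∀ j, 0 ≤ d j)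
    (hdh : ∀ i j, h i ≤ h j → d i ≤ d j)
    (hde : ∀ T : Finset ι, (∀ i ∈ T, ∀ j ∉ T, h j ≤ h i) → ∑ j ∈ T, d j ≤ ∑ j ∈ T, e j) :
    p d ≤ p e := by
  obtain ⟨y, hyd, hy⟩ := hp.exists_dual d
  obtain ⟨r, hr⟩ := exists_equiv_antitone h
  obtain ⟨q, hq⟩ := exists_equiv_antitone fun j => |y j|
  set π : Equiv.Perm ι := r.symm.trans q with hπ
  have hπr : ∀ i, π (r i) = q i := fun i => by simp [hπ]
  -- `π` rearranges `|y|` in the order of `h`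
  have hvary : Monovary d (fun j => |y (π j)|) := by
    intro i j hij
    apply hdh
    have : r.symm j ≤ r.symm i := by
      by_contra! hlt
      have := hq hlt.le
      simp only [Function.comp_apply] at this
      rw [← hπr, ← hπr] at this
      simp only [Equiv.apply_symm_apply] at this
      linarith
    simpa using hr this
  set s : ι → ℝ := fun j => if 0 ≤ y j then 1 else -1 with hs
  have hs1 : ∀ j, |s j| = 1 := fun j => by simp only [hs]; split_ifs <;> simp
  have hsy : ∀ j, s j * y j = |y j| := fun j => by
    simp only [hs]
    split_ifs with hj
    · rw [abs_of_nonneg hj, one_mul]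
    · rw [abs_of_neg (not_le.1 hj)]; ring
  -- Abel summation along the ordering `r`, in which `|y ∘ π|` is antitone
  have habel : ∑ j, d j * |y (π j)| ≤ ∑ j, e j * |y (π j)| := by
    have := sum_mul_nonneg_of_antitone (c := fun i => e (r i) - d (r i)) (y := fun i => |y (q i)|)
      hq (t := 0) (fun i => abs_nonneg _) (fun T hT => by
        have := hde (T.map r.toEmbedding) (by
          intro i hi j hj
          obtain ⟨i, hiT, rfl⟩ := Finset.mem_map.1 hi
          obtain ⟨j, rfl⟩ := r.surjective j
          exact hr (hT i hiT j fun h => hj (Finset.mem_map_of_mem _ h)))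
        simpa [Finset.sum_sub_distrib] using this)
    rw [← sub_nonneg, ← Finset.sum_sub_distrib, ← Equiv.sum_comp r]
    convert this using 2 with i
    rw [hπr]; ring
  calc p d = ∑ j, d j * y j := hyd.symm
    _ ≤ ∑ j, d j * |y j| := Finset.sum_le_sum fun j _ =>
        mul_le_mul_of_nonneg_left (le_abs_self _) (hd j)
    _ = ∑ j, d j * |y (π (π.symm j))| := by simp
    _ ≤ ∑ j, d j * |y (π j)| :=
        hvary.sum_mul_comp_perm_le_sum_mul
    _ ≤ ∑ j, e j * |y (π j)| := habel
    _ = ∑ j, e (π.symm j) * |y j| := by rw [← Equiv.sum_comp π fun j => e (π.symm j) * |y j|]; simp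
    _ = ∑ j, (s * (e ∘ π.symm)) j * y j := by
        refine Finset.sum_congr rfl fun j _ => ?_
        rw [← hsy, Pi.mul_apply, Function.comp_apply]; ring
    _ ≤ p (s * (e ∘ π.symm)) := hy _
    _ = p e := by rw [hp.sign s hs1, hp.perm]

/-! ### Symmetric norms: diagonal matrices and pinching -/

namespace IsSymmetricNorm

variable {n : Type*} [Fintype n] [DecidableEq n] {N : Matrix n n ℂ → ℝ}

/-- A symmetric norm restricted to real diagonal matrices. -/
theorem isSymmetricGauge (hN : IsSymmetricNorm N) :
    IsSymmetricGauge fun x : n → ℝ => N (Matrix.diagonal fun j => (x j : ℂ)) where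
  smul c x := by
    have : (Matrix.diagonal fun j => ((c • x) j : ℂ)) =
        (c : ℂ) • Matrix.diagonal fun j => (x j : ℂ) := by
      ext i j; by_cases h : i = j <;> simp [Matrix.diagonal, h]
    rw [this, hN.smul, Complex.norm_real, Real.norm_eq_abs]
  add_le x y := by
    have : (Matrix.diagonal fun j => ((x + y) j : ℂ)) =
        (Matrix.diagonal fun j => (x j : ℂ)) + Matrix.diagonal fun j => (y j : ℂ) := by
      rw [Matrix.diagonal_add]; simp
    rw [this]
    exact hN.add_le _ _
  perm π x := by
    have hU : (1 : Matrix n n ℂ).submatrix π id ∈ Matrix.unitaryGroup n ℂ := by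
      rw [Matrix.mem_unitaryGroup_iff, Matrix.star_eq_conjTranspose, Matrix.conjTranspose_submatrix]
      simpa using Matrix.submatrix_mul_equiv (1 : Matrix n n ℂ) 1 π (Equiv.refl n) π
    have : (Matrix.diagonal fun j => ((x ∘ π) j : ℂ)) = (1 : Matrix n n ℂ).submatrix π id *
        (Matrix.diagonal fun j => (x j : ℂ)) * star ((1 : Matrix n n ℂ).submatrix π id) := by
      ext i j
      by_cases hij : i = j <;>
        simp [Matrix.mul_apply, Matrix.one_apply, Matrix.star_apply, Matrix.diagonal_apply, hij]
    rw [this]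
    exact hN.unitary_mul_mul _ hU _ (Unitary.star_mem hU) _
  sign s hs x := by
    have hU : (Matrix.diagonal fun j => (s j : ℂ)) ∈ Matrix.unitaryGroup n ℂ := by
      rw [Matrix.mem_unitaryGroup_iff, Matrix.star_eq_conjTranspose,
        Matrix.diagonal_conjTranspose, Matrix.diagonal_mul_diagonal, ← Matrix.diagonal_one]
      congr 1
      ext j
      have : s j * s j = 1 := by rw [← abs_mul_abs_self, hs, one_mul]
      simpa using mod_cast this
    have : (Matrix.diagonal fun j => ((s * x) j : ℂ)) = (Matrix.diagonal fun j => (s j : ℂ)) *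
        (Matrix.diagonal fun j => (x j : ℂ)) * 1 := by
      rw [mul_one, Matrix.diagonal_mul_diagonal]; simp
    rw [this]
    exact hN.unitary_mul_mul _ hU _ (one_mem _) _

/-- Pinching: the diagonal part of `X` is the average of the conjugates of `X` by all diagonal sign
matrices. -/
theorem diagonal_diag_le (hN : IsSymmetricNorm N) (X : Matrix n n ℂ) :
    N (Matrix.diagonal X.diag) ≤ N X := by
  let D : (n → ℤˣ) → Matrix n n ℂ := fun s => Matrix.diagonal fun i => ((s i : ℤ) : ℂ)
  have hsq : ∀ u : ℤˣ, ((u : ℤ) : ℂ) * ((u : ℤ) : ℂ) = 1 := fun u => by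
    rcases Int.units_eq_one_or u with rfl | rfl <;> simp
  have hD : ∀ s, D s ∈ Matrix.unitaryGroup n ℂ := fun s => by
    rw [Matrix.mem_unitaryGroup_iff, Matrix.star_eq_conjTranspose,
      Matrix.diagonal_conjTranspose, Matrix.diagonal_mul_diagonal, ← Matrix.diagonal_one]
    congr 1
    ext j
    simpa using hsq (s j)
  have havg : ∑ s, D s * X * D s =
      ((Fintype.card (n → ℤˣ) : ℝ) : ℂ) • Matrix.diagonal X.diag := by
    ext i j
    simp only [Matrix.sum_apply, D, Matrix.diagonal_mul, Matrix.mul_diagonal, Matrix.smul_apply,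
      Matrix.diagonal_apply, Matrix.diag_apply]
    by_cases hij : i = j
    · subst hij
      have : ∀ s : n → ℤˣ, ((s i : ℤ) : ℂ) * X i i * ((s i : ℤ) : ℂ) = X i i := fun s => by
        rw [mul_right_comm, hsq, one_mul]
      simp [this]
    -- flipping the `i`-th sign changes the sign of the off-diagonal sum
    · have hflip := Equiv.sum_comp (Equiv.mulRight (Pi.mulSingle i (-1 : ℤˣ)))
        fun s : n → ℤˣ => ((s i : ℤ) : ℂ) * X i j * ((s j : ℤ) : ℂ)
      simp only [Equiv.coe_mulRight, Pi.mul_apply, Pi.mulSingle_eq_same,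
        Pi.mulSingle_eq_of_ne (Ne.symm hij), mul_one, mul_neg, Units.val_neg,
        Int.cast_neg, neg_mul, Finset.sum_neg_distrib] at hflip
      rw [if_neg hij, smul_zero]
      exact self_eq_neg.1 hflip.symm
  have hsum : ∀ S : Finset (n → ℤˣ), N (∑ s ∈ S, D s * X * D s) ≤ S.card * N X := fun S => by
    induction S using Finset.induction_on with
    | empty => simp [(hN.eq_zero_iff 0).2 rfl]
    | insert s S hs ih =>
      rw [Finset.sum_insert hs, Finset.card_insert_of_notMem hs]
      have := hN.add_le (D s * X * D s) (∑ s ∈ S, D s * X * D s)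
      rw [hN.unitary_mul_mul _ (hD s) _ (hD s)] at this
      push_cast
      linarith
  have h := hsum Finset.univ
  rw [havg, hN.smul, Finset.card_univ, Complex.norm_real, Real.norm_natCast] at h
  exact le_of_mul_le_mul_left h (by exact_mod_cast Fintype.card_pos)

theorem unitary_conj (hN : IsSymmetricNorm N) (U : Matrix.unitaryGroup n ℂ) (X : Matrix n n ℂ) :
    N ((U : Matrix n n ℂ) * X * (U : Matrix n n ℂ)ᴴ) = N X :=
  hN.unitary_mul_mul _ U.2 _ (Unitary.star_mem U.2) _

end IsSymmetricNorm

/-! ### Expansive congruences between diagonal matrices -/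

section Congruence

variable {n : Type*} [Fintype n] [DecidableEq n]

theorem mul_diagonal_mul_conjTranspose_apply_self (W : Matrix n n ℂ) (a : n → ℝ) (j : n) :
    (W * Matrix.diagonal (fun i => (a i : ℂ)) * Wᴴ) j j = ((∑ i, a i * ‖W j i‖ ^ 2 : ℝ) : ℂ) := by
  rw [Matrix.mul_apply]
  push_cast
  refine Finset.sum_congr rfl fun i _ => ?_
  rw [Matrix.mul_diagonal, Matrix.conjTranspose_apply, ← Complex.mul_conj']
  simp only [RCLike.star_def]
  ring

/-- The rank-one matrix `a i • w wᴴ`, `w` the `i`-th column of `W`, is at most `W diag(a) Wᴴ`,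
written out on the vector with coordinates `star (x j)`. -/
theorem mul_normSq_sum_le {W : Matrix n n ℂ} {a h : n → ℝ} (ha : ∀ i, 0 ≤ a i)
    (hW : W * Matrix.diagonal (fun i => (a i : ℂ)) * Wᴴ = Matrix.diagonal fun j => (h j : ℂ))
    (i : n) (x : n → ℂ) :
    a i * ‖∑ j, x j * W j i‖ ^ 2 ≤ ∑ j, h j * ‖x j‖ ^ 2 := by
  have key : (Matrix.of fun _ : n => x) * W * Matrix.diagonal (fun i => (a i : ℂ)) *
      ((Matrix.of fun _ : n => x) * W)ᴴ = (Matrix.of fun _ : n => x) *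
        Matrix.diagonal (fun j => (h j : ℂ)) * (Matrix.of fun _ : n => x)ᴴ := by
    rw [← hW, Matrix.conjTranspose_mul]
    simp only [Matrix.mul_assoc]
  have := congrFun (congrFun key i) i
  rw [mul_diagonal_mul_conjTranspose_apply_self, mul_diagonal_mul_conjTranspose_apply_self,
    Complex.ofReal_inj] at this
  simp only [Matrix.of_apply, Matrix.mul_apply] at this
  rw [← this]
  exact Finset.single_le_sum (f := fun i => a i * ‖∑ j, x j * W j i‖ ^ 2)
    (fun i _ => mul_nonneg (ha i) (sq_nonneg _)) (Finset.mem_univ i)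

theorem one_le_sum_normSq_row {W : Matrix n n ℂ} (hW : (W * Wᴴ - 1).PosSemidef) (j : n) :
    1 ≤ ∑ i, ‖W j i‖ ^ 2 := by
  have h := hW.diag_nonneg (i := j)
  have := mul_diagonal_mul_conjTranspose_apply_self W (fun _ => 1) j
  simp only [Complex.ofReal_one, Matrix.diagonal_one, mul_one, one_mul] at this
  rw [Matrix.sub_apply, this, Matrix.one_apply_eq, sub_nonneg] at h
  exact_mod_cast h

/-- If `W Wᴴ ≥ 1` then `Wᴴ W ≥ 1`: with `X = Wᴴ⁻¹`, one has
`Wᴴ W - 1 = (W - X)ᴴ (W - X) + Xᴴ (W Wᴴ - 1) X`. -/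
theorem posSemidef_conjTranspose_mul_self_sub_one {W : Matrix n n ℂ}
    (hW : (W * Wᴴ - 1).PosSemidef) : (Wᴴ * W - 1).PosSemidef := by
  have hpd : (W * Wᴴ).PosDef := by
    simpa using Matrix.PosDef.add_posSemidef Matrix.PosDef.one hW
  have hdet : IsUnit Wᴴ.det := by
    have := (Matrix.isUnit_iff_isUnit_det _).1 hpd.isUnit
    rw [Matrix.det_mul] at this
    exact isUnit_of_mul_isUnit_right this
  have h1 : Wᴴ * Wᴴ⁻¹ = 1 := Matrix.mul_nonsing_inv _ hdet
  set X := Wᴴ⁻¹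
  have h2 : Xᴴ * W = 1 := by
    have := congrArg Matrix.conjTranspose h1
    simpa using this
  have key : Wᴴ * W - 1 = (W - X)ᴴ * (W - X) + Xᴴ * (W * Wᴴ - 1) * X := by
    have e : Xᴴ * (W * Wᴴ - 1) * X = 1 - Xᴴ * X := by
      rw [Matrix.mul_sub, Matrix.sub_mul, ← Matrix.mul_assoc, h2, Matrix.one_mul, h1,
        Matrix.mul_one]
    rw [e, Matrix.conjTranspose_sub, Matrix.sub_mul, Matrix.mul_sub, Matrix.mul_sub, h1, h2]
    abel
  rw [key]
  exact (Matrix.posSemidef_conjTranspose_mul_self _).add (hW.conjTranspose_mul_mul_same X)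

/-- The diagonal of `W diag(f a) Wᴴ` weakly majorizes `f h` when `W diag(a) Wᴴ = diag(h)` and `W` is
expansive. -/
theorem sum_map_le_sum_diag {f : ℝ → ℝ} (hf : ConcaveOn ℝ (Set.Ici 0) f) (hf0 : 0 ≤ f 0)
    {W : Matrix n n ℂ} {a h : n → ℝ} (ha : ∀ i, 0 ≤ a i)
    (hW : W * Matrix.diagonal (fun i => (a i : ℂ)) * Wᴴ = Matrix.diagonal fun j => (h j : ℂ))
    (hexp : (W * Wᴴ - 1).PosSemidef) {T : Finset n} (hT : ∀ i ∈ T, ∀ j ∉ T, h j ≤ h i) :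
    ∑ j ∈ T, f (h j) ≤ ∑ j ∈ T, ∑ i, f (a i) * ‖W j i‖ ^ 2 := by
  have hdiag : ∀ j, h j = ∑ i, a i * ‖W j i‖ ^ 2 := fun j => by
    have := mul_diagonal_mul_conjTranspose_apply_self W a j
    rw [hW, Matrix.diagonal_apply_eq] at this
    exact_mod_cast this
  have hh : ∀ j, 0 ≤ h j := fun j => by
    rw [hdiag]
    exact Finset.sum_nonneg fun i _ => mul_nonneg (ha i) (sq_nonneg _)
  set g : ℝ → ℝ := fun t => f t - f 0 with hg_def
  have hg : ConcaveOn ℝ (Set.Ici 0) g := hf.sub (convexOn_const _ (convex_Ici 0))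
  have hg0 : g 0 = 0 := sub_self _
  have hgh : ∀ j, g (h j) = ∑ i, ‖W j i‖ ^ 2 * (a i * (g (h j) / h j)) := fun j => by
    rcases (hh j).eq_or_lt with hj | hj
    · simp [← hj, hg0]
    · calc g (h j) = h j * (g (h j) / h j) := by field_simp
        _ = (∑ i, a i * ‖W j i‖ ^ 2) * (g (h j) / h j) := by rw [← hdiag]
        _ = _ := by
          rw [Finset.sum_mul]
          exact Finset.sum_congr rfl fun i _ => by ring
  have hcol : ∀ i, ∑ j ∈ T, ‖W j i‖ ^ 2 * (a i * (g (h j) / h j)) ≤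
      ∑ j ∈ T, ‖W j i‖ ^ 2 * g (a i) := by
    intro i
    rcases (ha i).eq_or_lt with hi | hi
    · simp [← hi, hg0]
    have hW0 : ∀ j, h j = 0 → W j i = 0 := fun j hj => by
      rw [hdiag, Finset.sum_eq_zero_iff_of_nonneg
        fun i _ => mul_nonneg (ha i) (sq_nonneg _)] at hj
      simpa [hi.ne'] using hj i (Finset.mem_univ i)
    refine sum_concave_le_of_sum_div_le hg hg0 hi hh (fun j => sq_nonneg _)
      (fun j hj => by simp [hW0 j hj]) ?_ ?_ hT
    · have := one_le_sum_normSq_row (W := Wᴴ)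
        (by simpa using posSemidef_conjTranspose_mul_self_sub_one hexp) i
      simpa using this
    -- test the positive semidefinite order on the vector `H⁻¹ w`, `w` the `i`-th column of `W`
    · set s := ∑ j, ‖W j i‖ ^ 2 / h j with hs
      have hs0 : 0 ≤ s := Finset.sum_nonneg fun j _ => div_nonneg (sq_nonneg _) (hh j)
      have h1 := mul_normSq_sum_le ha hW i fun j => star (W j i) / (h j : ℂ)
      have h2 : ∑ j, star (W j i) / (h j : ℂ) * W j i = (s : ℂ) := by
        rw [hs]
        push_cast
        refine Finset.sum_congr rfl fun j _ => ?_
        rw [← Complex.mul_conj', RCLike.star_def]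
        ring
      have h3 : ∑ j, h j * ‖star (W j i) / (h j : ℂ)‖ ^ 2 = s := by
        refine Finset.sum_congr rfl fun j _ => ?_
        rw [norm_div, norm_star, Complex.norm_real, Real.norm_eq_abs, div_pow, sq_abs]
        rcases (hh j).eq_or_lt with hj | hj
        · simp [← hj]
        · field_simp
      rw [h2, h3, Complex.norm_real, Real.norm_eq_abs, sq_abs] at h1
      rw [le_div_iff₀ hi]
      by_contra! hlt
      have : 0 < s := by
        by_contra! hle
        rw [le_antisymm hle hs0, zero_mul] at hlt
        linarith
      nlinarith
  have hrow : ∀ j, f 0 ≤ f 0 * ∑ i, ‖W j i‖ ^ 2 := fun j =>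
    le_mul_of_one_le_right hf0 (one_le_sum_normSq_row hexp j)
  calc ∑ j ∈ T, f (h j) = ∑ j ∈ T, f 0 + ∑ j ∈ T, g (h j) := by
        rw [← Finset.sum_add_distrib]
        exact Finset.sum_congr rfl fun j _ => by simp [hg_def]
    _ = ∑ j ∈ T, f 0 + ∑ i, ∑ j ∈ T, ‖W j i‖ ^ 2 * (a i * (g (h j) / h j)) := by
        rw [Finset.sum_comm, Finset.sum_congr rfl fun j _ => hgh j]
    _ ≤ ∑ j ∈ T, f 0 * ∑ i, ‖W j i‖ ^ 2 + ∑ i, ∑ j ∈ T, ‖W j i‖ ^ 2 * g (a i) :=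
        add_le_add (Finset.sum_le_sum fun j _ => hrow j) (Finset.sum_le_sum fun i _ => hcol i)
    _ = ∑ j ∈ T, ∑ i, f (a i) * ‖W j i‖ ^ 2 := by
        rw [Finset.sum_comm, ← Finset.sum_add_distrib]
        refine Finset.sum_congr rfl fun j _ => ?_
        rw [Finset.mul_sum, ← Finset.sum_add_distrib]
        exact Finset.sum_congr rfl fun i _ => by simp only [hg_def]; ring

theorem Matrix.IsHermitian.eq_mul_diagonal_mul {A : Matrix n n ℂ} (hA : A.IsHermitian) :
    A = (hA.eigenvectorUnitary : Matrix n n ℂ) *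
      Matrix.diagonal (fun i => (hA.eigenvalues i : ℂ)) *
        (hA.eigenvectorUnitary : Matrix n n ℂ)ᴴ := by
  conv_lhs => rw [hA.spectral_theorem, Unitary.conjStarAlgAut_apply]
  rfl

theorem Matrix.IsHermitian.cfc_eq_mul_diagonal_mul {A : Matrix n n ℂ} (hA : A.IsHermitian)
    (f : ℝ → ℝ) : cfc f A = (hA.eigenvectorUnitary : Matrix n n ℂ) *
      Matrix.diagonal (fun i => (f (hA.eigenvalues i) : ℂ)) *
        (hA.eigenvectorUnitary : Matrix n n ℂ)ᴴ := by
  rw [hA.cfc_eq f, Matrix.IsHermitian.cfc, Unitary.conjStarAlgAut_apply]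
  rfl

end Congruence

/-! ### The norm inequality -/

theorem theorem2p1 {n : Type*} [Fintype n] [DecidableEq n]
    (f : ℝ → ℝ) (hf : ConcaveOn ℝ (Set.Ici 0) f) (hf0 : ∀ t, 0 ≤ t → 0 ≤ f t)
    (A Z : Matrix n n ℂ) (hA : A.PosSemidef) (hZ : IsExpansive Z)
    (N : Matrix n n ℂ → ℝ) (hN : IsSymmetricNorm N) :
    N (cfc f (Zᴴ * A * Z)) ≤ N (Zᴴ * cfc f A * Z) := by
  have hH : (Zᴴ * A * Z).PosSemidef := hA.conjTranspose_mul_mul_same Z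
  have hspecA := hA.isHermitian.eq_mul_diagonal_mul
  have hspecH := hH.isHermitian.eq_mul_diagonal_mul
  rw [hA.isHermitian.cfc_eq_mul_diagonal_mul f, hH.isHermitian.cfc_eq_mul_diagonal_mul f]
  set U := hH.isHermitian.eigenvectorUnitary
  set V := hA.isHermitian.eigenvectorUnitary
  set a := hA.isHermitian.eigenvalues
  set h := hH.isHermitian.eigenvalues
  have hU : (U : Matrix n n ℂ)ᴴ * U = 1 := Unitary.coe_star_mul_self U
  have hV : (V : Matrix n n ℂ) * (V : Matrix n n ℂ)ᴴ = 1 := Unitary.coe_mul_star_self V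
  have hU' : ∀ X : Matrix n n ℂ, (U : Matrix n n ℂ)ᴴ * (U * X) = X := fun X => by
    rw [← Matrix.mul_assoc, hU, Matrix.one_mul]
  have hV' : ∀ X : Matrix n n ℂ, (V : Matrix n n ℂ) * ((V : Matrix n n ℂ)ᴴ * X) = X := fun X => by
    rw [← Matrix.mul_assoc, hV, Matrix.one_mul]
  set W : Matrix n n ℂ := (U : Matrix n n ℂ)ᴴ * Zᴴ * V with hWdef
  have hWstar : Wᴴ = (V : Matrix n n ℂ)ᴴ * Z * U := by
    simp [hWdef, Matrix.mul_assoc]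
  have hconj : ∀ D : Matrix n n ℂ, W * D * Wᴴ =
      (U : Matrix n n ℂ)ᴴ * (Zᴴ * ((V : Matrix n n ℂ) * D * (V : Matrix n n ℂ)ᴴ) * Z) * U :=
    fun D => by rw [hWstar, hWdef]; simp only [Matrix.mul_assoc]
  have hW : W * Matrix.diagonal (fun i => (a i : ℂ)) * Wᴴ =
      Matrix.diagonal fun j => (h j : ℂ) := by
    rw [hconj]
    rw [← hspecA, hspecH]
    simp only [Matrix.mul_assoc, hU', hU, Matrix.mul_one]
  have hexp : (W * Wᴴ - 1).PosSemidef := by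
    have : W * Wᴴ - 1 = (U : Matrix n n ℂ)ᴴ * (Zᴴ * Z - 1) * U := by
      rw [hWstar, hWdef, Matrix.mul_sub, Matrix.sub_mul, Matrix.mul_one, hU]
      simp only [Matrix.mul_assoc, hV']
    rw [this]
    exact Matrix.PosSemidef.conjTranspose_mul_mul_same hZ _
  have ha : ∀ i, 0 ≤ a i := hA.eigenvalues_nonneg
  have hh : ∀ j, 0 ≤ h j := hH.eigenvalues_nonneg
  have hdiag : (W * Matrix.diagonal (fun i => (f (a i) : ℂ)) * Wᴴ).diag =
      fun j => ((∑ i, f (a i) * ‖W j i‖ ^ 2 : ℝ) : ℂ) := funext fun j =>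
    mul_diagonal_mul_conjTranspose_apply_self W (fun i => f (a i)) j
  calc N (U * Matrix.diagonal (fun j => (f (h j) : ℂ)) * (U : Matrix n n ℂ)ᴴ)
      = N (Matrix.diagonal fun j => (f (h j) : ℂ)) := hN.unitary_conj U _
    _ ≤ N (Matrix.diagonal fun j => ((∑ i, f (a i) * ‖W j i‖ ^ 2 : ℝ) : ℂ)) :=
        hN.isSymmetricGauge.le_of_sum_le (h := h) (fun j => hf0 _ (hh j))
          (fun i j hij => hf.monotoneOn_of_nonneg hf0 (hh i) (hh j) hij)
          fun T hT => sum_map_le_sum_diag hf (hf0 0 le_rfl) ha hW hexp hT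
    _ ≤ N (W * Matrix.diagonal (fun i => (f (a i) : ℂ)) * Wᴴ) := by
        rw [← hdiag]
        exact hN.diagonal_diag_le _
    _ = N (Zᴴ * (V * Matrix.diagonal (fun i => (f (a i) : ℂ)) * (V : Matrix n n ℂ)ᴴ) * Z) := by
        rw [hconj]
        exact hN.unitary_mul_mul _ (Unitary.star_mem U.2) _ U.2 _
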